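/- Let $\mathbb{H}$ be the quaternions with imaginary units $\mathbf{e}_1,\mathbf{e}_2,\mathbf{e}_3$, $\mathbf{e}_1\mathbf{e}_2=\mathbf{e}_3$, let $\mathcal{A}=\mathrm{span}_{\mathbb{R}}\{1,\mathbf{e}_1,\mathbf{e}_2\}\subset\mathbb{H}$ be the space of reduced quaternions, let $|\cdot|$ be the Euclidean norm and $\mathbf{Sc}$ the scalar (real) part. Let $B=\{x\in\mathbb{R}^3: |x|<1\}$, with coordinates $x=(x_0,x_1,x_2)$, and put $$D=\frac{\partial}{\partial x_0}+\mathbf{e}_1\frac{\partial}{\partial x_1}+\mathbf{e}_2\frac{\partial}{\partial x_2},\qquad \overline{D}=\frac{\partial}{\partial x_0}-\mathbf{e}_1\frac{\partial}{\partial x_1}-\mathbf{e}_2\frac{\partial}{\partial x_2}.$$ Let $\mathbf{f}:B\to\mathcal{A}$ be square integrable with respect to Lebesgue measure and monogenic in $B$, that is, continuously real-differentiable with $D\mathbf{f}=0$ in $B$. Then, for every $0\le r<1$, the maximum of $|(\tfrac12\overline{D})\mathbf{f}|$ over the sphere $|x|=r$ is attained and $$\max_{|x|=r}\left|\left(\tfrac12\overline{D}\right)\mathbf{f}(x)\right|\;\le\;\frac{8(3r+1)}{(1-r)^5}\left(\sup_{|\xi|<1}|\mathbf{f}(\xi)|-|\mathbf{Sc}\{\mathbf{f}(0)\}|\right),$$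 where the right-hand side is $+\infty$ if $\mathbf{f}$ is unbounded in $B$. -/

import Mathlib

open scoped Quaternion ENNReal

noncomputable section

namespace Riesz

/-- Euclidean space `ℝ³`, with coordinates `x 0, x 1, x 2`. -/
abbrev R3 : Type := EuclideanSpace ℝ (Fin 3)

/-- The imaginary unit `e₁`. -/
def e₁ : ℍ[ℝ] := ⟨0, 1, 0, 0⟩

/-- The imaginary unit `e₂`. -/
def e₂ : ℍ[ℝ] := ⟨0, 0, 1, 0⟩

/-- The reduced quaternions: the real span of `1, e₁, e₂`. -/
def reducedQuaternions : Submodule ℝ ℍ[ℝ] := Submodule.span ℝ {1, e₁, e₂}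

/-- The partial derivative `∂f/∂xᵢ` at `x`. -/
def partialD (i : Fin 3) (f : R3 → ℍ[ℝ]) (x : R3) : ℍ[ℝ] :=
  fderiv ℝ f x (EuclideanSpace.single i 1)

/-- The generalized Cauchy–Riemann operator `D = ∂₀ + e₁ ∂₁ + e₂ ∂₂`. -/
def cauchyRiemann (f : R3 → ℍ[ℝ]) (x : R3) : ℍ[ℝ] :=
  partialD 0 f x + e₁ * partialD 1 f x + e₂ * partialD 2 f x

/-- The conjugate operator `D̄ = ∂₀ - e₁ ∂₁ - e₂ ∂₂`. -/
def cauchyRiemannConj (f : R3 → ℍ[ℝ]) (x : R3) : ℍ[ℝ] :=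
  partialD 0 f x - e₁ * partialD 1 f x - e₂ * partialD 2 f x

/-- The hypercomplex derivative `(½ D̄) f`. -/
def hypercomplexDeriv (f : R3 → ℍ[ℝ]) (x : R3) : ℍ[ℝ] :=
  (1 / 2 : ℝ) • cauchyRiemannConj f x

/-- `f` is a monogenic function on the open set `Ω` with values in the reduced quaternions
(the values of `f` outside `Ω` play no role). -/
structure IsMonogenicOn (f : R3 → ℍ[ℝ]) (Ω : Set R3) : Prop where
  mem_reduced : ∀ x ∈ Ω, f x ∈ reducedQuaternions
  contDiffOn : ContDiffOn ℝ 1 f Ω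
  cauchyRiemann_eq_zero : ∀ x ∈ Ω, cauchyRiemann f x = 0

/-- `sup_{|ξ| < r} |f(ξ)|`, an element of `[0, ∞]`. -/
def supModulus (f : R3 → ℍ[ℝ]) (r : ℝ) : ℝ≥0∞ :=
  ⨆ ξ ∈ Metric.ball (0 : R3) r, ‖f ξ‖ₑ

/-- The maximum modulus function `max_{|x| = r} |f(x)|`, as a supremum in `[0, ∞]`. -/
def maxModulus (f : R3 → ℍ[ℝ]) (r : ℝ) : ℝ≥0∞ :=
  ⨆ x ∈ Metric.sphere (0 : R3) r, ‖f x‖ₑ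

end Riesz

end

namespace Riesz

open MeasureTheory Metric Set Filter Topology

/-! Write u, u₁, u₂ for the components of `f`. The equation `D f = 0` is the Riesz system; it gives
`½ D̄ f = ∂₀ f`, of modulus |∇u|, so everything reduces to a gradient bound for u.

The mean value property of u is obtained with first derivatives only. By the Riesz system, y·∇u is a
sum of rotational derivatives of u₁ and u₂; these integrate to zero over centred balls, so the
integral of u(x + ty) over |y| ≤ ρ does not depend on t (`setIntegral_closedBall_eq_of_radial_eq`).

For w = M - u ≥ 0, comparing integrals over nested balls gives a Harnack inequality
(`HasBallMeanValue.pow_mul_le`) and, infinitesimally, ρ|∇w| ≤ 3w (`HasBallMeanValue.mul_fderiv_le`).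
Combined, they bound |∇u(x)| by 8(M - |u(0)|)/(1 - |x|)⁴, which is stronger than the claim. -/

/-- Differentiation under the integral sign, along a family of curves, over a compact set. -/
theorem hasDerivAt_setIntegral_comp {g : R3 → ℝ} {U K : Set R3} (hU : IsOpen U)
    (hg : ContDiffOn ℝ 1 g U) (hK : IsCompact K) {γ γ' : ℝ → R3 → R3}
    (hγ : Continuous (Function.uncurry γ)) (hγ' : Continuous (Function.uncurry γ'))
    (hd : ∀ t y, HasDerivAt (fun s => γ s y) (γ' t y) t) {t₀ : ℝ} (ht₀ : ∀ y ∈ K, γ t₀ y ∈ U) :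
    HasDerivAt (fun t => ∫ y in K, g (γ t y)) (∫ y in K, fderiv ℝ g (γ t₀ y) (γ' t₀ y)) t₀ := by
  have hfd : ContinuousOn (fderiv ℝ g) U := hg.continuousOn_fderiv_of_isOpen hU le_rfl
  have hcont : ∀ t y, γ t y ∈ U →
      ContinuousAt (fun p : ℝ × R3 => fderiv ℝ g (γ p.1 p.2) (γ' p.1 p.2)) (t, y) := by
    intro t y h
    have h1 : ContinuousAt (fderiv ℝ g) (Function.uncurry γ (t, y)) :=
      hfd.continuousAt (hU.mem_nhds h)
    exact (h1.comp hγ.continuousAt).clm_apply hγ'.continuousAt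
  have hslice : ∀ t, (∀ y ∈ K, γ t y ∈ U) →
      ContinuousOn (fun y => fderiv ℝ g (γ t y) (γ' t y)) K := by
    intro t h y hy
    have h2 : ContinuousAt (fun y : R3 => (t, y)) y := by fun_prop
    exact (ContinuousAt.comp (f := fun y : R3 => (t, y)) (hcont t y (h y hy)) h2).continuousWithinAt
  obtain ⟨C, hC⟩ := hK.exists_bound_of_continuousOn (hslice t₀ ht₀)
  have hmem : ∀ᶠ t in 𝓝 t₀, ∀ y ∈ K, γ t y ∈ U := by
    apply hK.eventually_forall_of_forall_eventually
    intro y hy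
    exact hγ.continuousAt.eventually_mem (hU.mem_nhds (ht₀ y hy))
  have hbd : ∀ᶠ t in 𝓝 t₀, ∀ y ∈ K, ‖fderiv ℝ g (γ t y) (γ' t y)‖ ≤ C + 1 := by
    apply hK.eventually_forall_of_forall_eventually
    intro y hy
    have h := (hcont t₀ y (ht₀ y hy)).norm.eventually_lt_const
      (lt_of_le_of_lt (hC y hy) (lt_add_one C))
    exact h.mono fun p hp => hp.le
  have hgK : ∀ t, (∀ y ∈ K, γ t y ∈ U) → ContinuousOn (fun y => g (γ t y)) K := by
    intro t h
    have h2 : Continuous (γ t) := hγ.comp (by fun_prop : Continuous fun y : R3 => (t, y))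
    exact hg.continuousOn.comp h2.continuousOn h
  refine (hasDerivAt_integral_of_dominated_loc_of_deriv_le (bound := fun _ => C + 1)
    (F' := fun t y => fderiv ℝ g (γ t y) (γ' t y)) (hmem.and hbd) ?_ ?_ ?_ ?_ ?_ ?_).2
  · exact hmem.mono fun t h => (hgK t h).aestronglyMeasurable hK.measurableSet
  · exact (hgK t₀ ht₀).integrableOn_compact hK
  · exact (hslice t₀ ht₀).aestronglyMeasurable hK.measurableSet
  · exact ae_restrict_of_forall_mem hK.measurableSet fun y hy t ht => ht.2 y hy
  · exact integrableOn_const hK.measure_lt_top.ne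
  · refine ae_restrict_of_forall_mem hK.measurableSet fun y hy t ht => ?_
    have h1 : DifferentiableAt ℝ g (γ t y) :=
      (hg.contDiffAt (hU.mem_nhds (ht.1 y hy))).differentiableAt (by norm_num)
    exact h1.hasFDerivAt.comp_hasDerivAt t (hd t y)

/-! ### Rotations and the mean value property -/

/-- The `i`-th coordinate vector of `ℝ³`. -/
noncomputable abbrev basisVec (i : Fin 3) : R3 := EuclideanSpace.single i 1

/-- The rotation by the angle `θ` in the plane of the coordinates `0` and `i`. -/
noncomputable def rotFun (i : Fin 3) (θ : ℝ) (y : R3) : R3 :=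
  y + ((Real.cos θ - 1) * y 0 - Real.sin θ * y i) • basisVec 0 +
    (Real.sin θ * y 0 + (Real.cos θ - 1) * y i) • basisVec i

/-- `rotFun` as a linear isometry, for `i ≠ 0`. -/
noncomputable def rot (i : Fin 3) (hi : i ≠ 0) (θ : ℝ) : R3 ≃ₗᵢ[ℝ] R3 :=
  LinearIsometry.toLinearIsometryEquiv
    { toFun := rotFun i θ
      map_add' := fun x y => by
        ext j
        simp only [rotFun, PiLp.add_apply, PiLp.smul_apply, smul_eq_mul]
        ring
      map_smul' := fun c x => by
        ext j
        simp only [rotFun, PiLp.add_apply, PiLp.smul_apply, smul_eq_mul, RingHom.id_apply]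
        ring
      norm_map' := fun y => by
        have h := Real.sin_sq_add_cos_sq θ
        rw [EuclideanSpace.norm_eq, EuclideanSpace.norm_eq]
        congr 1
        fin_cases i
        · exact absurd rfl hi
        · simp [rotFun, Fin.sum_univ_three]
          linear_combination ((y 0) ^ 2 + (y 1) ^ 2) * h
        · simp [rotFun, Fin.sum_univ_three]
          linear_combination ((y 0) ^ 2 + (y 2) ^ 2) * h } rfl

theorem setIntegral_closedBall_comp_rotFun {i : Fin 3} (hi : i ≠ 0) (θ ρ : ℝ) (g : R3 → ℝ) :
    ∫ y in closedBall (0 : R3) ρ, g (rotFun i θ y) = ∫ y in closedBall (0 : R3) ρ, g y := by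
  have h := (rot i hi θ).measurePreserving.setIntegral_preimage_emb
    (rot i hi θ).toHomeomorph.measurableEmbedding g (closedBall 0 ρ)
  rw [(rot i hi θ).preimage_closedBall, map_zero] at h
  exact h

/-- The integral over a ball of the derivative along an infinitesimal rotation vanishes. -/
theorem setIntegral_fderiv_rotation_eq_zero {g : R3 → ℝ} {U : Set R3} (hU : IsOpen U)
    (hg : ContDiffOn ℝ 1 g U) {i : Fin 3} (hi : i ≠ 0) {x : R3} {t ρ : ℝ} (ht : t ≠ 0)
    (hx : ∀ y ∈ closedBall (0 : R3) ρ, x + t • y ∈ U) :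
    ∫ y in closedBall (0 : R3) ρ,
      fderiv ℝ g (x + t • y) (y 0 • basisVec i - y i • basisVec 0) = 0 := by
  have hrot0 : ∀ y, rotFun i 0 y = y := fun y => by simp [rotFun]
  -- The integral of the rotated function is constant in θ; its derivative at θ = 0 is `t` times the
  -- integral in question.
  have key := hasDerivAt_setIntegral_comp hU hg (isCompact_closedBall (0 : R3) ρ)
    (γ := fun θ y => x + t • rotFun i θ y)
    (γ' := fun θ y => t • ((-Real.sin θ * y 0 - Real.cos θ * y i) • basisVec 0 +
      (Real.cos θ * y 0 - Real.sin θ * y i) • basisVec i))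
    (by unfold rotFun Function.uncurry; fun_prop) (by unfold Function.uncurry; fun_prop)
    (fun θ y => by
      have hs := Real.hasDerivAt_sin θ
      have hc := Real.hasDerivAt_cos θ
      have h0 := ((hc.sub_const 1).mul_const (y 0)).sub (hs.mul_const (y i))
      have h1 := (hs.mul_const (y 0)).add ((hc.sub_const 1).mul_const (y i))
      have h := ((((h0.smul_const (basisVec 0)).const_add y).add
        (h1.smul_const (basisVec i))).const_smul t).const_add x
      refine HasDerivAt.congr_deriv h ?_
      module) (t₀ := 0) (by simpa only [hrot0] using hx)
  have hconst : (fun θ => ∫ y in closedBall (0 : R3) ρ, g (x + t • rotFun i θ y)) =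
      fun _ => ∫ y in closedBall (0 : R3) ρ, g (x + t • y) := by
    funext θ
    exact setIntegral_closedBall_comp_rotFun hi θ ρ (fun y => g (x + t • y))
  rw [hconst] at key
  have h0 := key.unique (hasDerivAt_const _ _)
  simp only [hrot0, Real.sin_zero, Real.cos_zero, map_smul, smul_eq_mul] at h0
  rw [integral_const_mul] at h0
  rw [← (mul_eq_zero.1 h0).resolve_left ht]
  congr 1
  funext y
  congr 1
  module

/-- The mean value property on balls for a function whose radial derivatives are combinations of
rotational derivatives of two further functions. -/
theorem setIntegral_closedBall_eq_of_radial_eq {u u₁ u₂ : R3 → ℝ} {U : Set R3} (hU : IsOpen U)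
    (hu : ContDiffOn ℝ 1 u U) (hu₁ : ContDiffOn ℝ 1 u₁ U) (hu₂ : ContDiffOn ℝ 1 u₂ U)
    (hrel : ∀ z ∈ U, ∀ y : R3, fderiv ℝ u z y =
      fderiv ℝ u₁ z (y 0 • basisVec 1 - y 1 • basisVec 0) +
        fderiv ℝ u₂ z (y 0 • basisVec 2 - y 2 • basisVec 0))
    {x : R3} {ρ : ℝ} (hx : closedBall x ρ ⊆ U) :
    ∫ y in closedBall x ρ, u y = volume.real (closedBall (0 : R3) ρ) * u x := by
  set K := closedBall (0 : R3) ρ with hKdef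
  have hK : IsCompact K := isCompact_closedBall _ _
  have hmem : ∀ t ∈ Icc (0 : ℝ) 1, ∀ y ∈ K, x + t • y ∈ U := by
    intro t ht y hy
    apply hx
    rw [hKdef, mem_closedBall_zero_iff] at hy
    rw [mem_closedBall, dist_self_add_left, norm_smul, Real.norm_of_nonneg ht.1]
    nlinarith [norm_nonneg y, ht.2]
  have hder : ∀ t ∈ Icc (0 : ℝ) 1, HasDerivAt (fun t => ∫ y in K, u (x + t • y))
      (∫ y in K, fderiv ℝ u (x + t • y) y) t := by
    intro t ht
    refine hasDerivAt_setIntegral_comp hU hu hK (γ := fun t y => x + t • y) (γ' := fun _ y => y)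
      (by unfold Function.uncurry; fun_prop) (by unfold Function.uncurry; fun_prop) ?_ (hmem t ht)
    intro s y
    simpa using ((hasDerivAt_id s).smul_const y).const_add x
  have hzero : ∀ t ∈ Ioo (0 : ℝ) 1, ∫ y in K, fderiv ℝ u (x + t • y) y = 0 := by
    intro t ht
    have hm := hmem t ⟨ht.1.le, ht.2.le⟩
    have hint : ∀ (v : R3 → ℝ), ContDiffOn ℝ 1 v U → ∀ i : Fin 3, IntegrableOn
        (fun y : R3 => fderiv ℝ v (x + t • y) (y 0 • basisVec i - y i • basisVec 0)) K := by
      intro v hv i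
      have h1 : ContinuousOn (fun y : R3 => fderiv ℝ v (x + t • y)) K :=
        (hv.continuousOn_fderiv_of_isOpen hU le_rfl).comp
          (by fun_prop : Continuous fun y : R3 => x + t • y).continuousOn hm
      exact (h1.clm_apply (by fun_prop)).integrableOn_compact hK
    rw [setIntegral_congr_fun hK.measurableSet (fun y hy => hrel _ (hm y hy) y),
      integral_add (hint u₁ hu₁ 1) (hint u₂ hu₂ 2),
      setIntegral_fderiv_rotation_eq_zero hU hu₁ (by decide) ht.1.ne' hm,
      setIntegral_fderiv_rotation_eq_zero hU hu₂ (by decide) ht.1.ne' hm, add_zero]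
  -- The derivative is known to vanish only for 0 < t < 1, which suffices for the mean value theorem
  -- between t = 0 (the constant u(x)) and t = 1 (the translated ball).
  obtain ⟨c, hc, hslope⟩ := exists_hasDerivAt_eq_slope (fun t => ∫ y in K, u (x + t • y))
    (fun t => ∫ y in K, fderiv ℝ u (x + t • y) y) zero_lt_one
    (fun t ht => (hder t ht).continuousAt.continuousWithinAt)
    (fun t ht => hder t ⟨ht.1.le, ht.2.le⟩)
  rw [hzero c hc] at hslope
  simp only [one_smul, zero_smul, add_zero, sub_zero, div_one, setIntegral_const,
    smul_eq_mul] at hslope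
  have htrans := (measurePreserving_add_left volume x).setIntegral_preimage_emb
    (measurableEmbedding_addLeft x) u (closedBall x ρ)
  rw [preimage_add_closedBall, sub_self] at htrans
  linarith

/-! ### Harnack comparison and gradient estimate -/

/-- The mean value property on the closed balls contained in `U`. -/
def HasBallMeanValue (w : R3 → ℝ) (U : Set R3) : Prop :=
  ∀ ⦃x : R3⦄ ⦃ρ : ℝ⦄, closedBall x ρ ⊆ U →
    ∫ y in closedBall x ρ, w y = volume.real (closedBall (0 : R3) ρ) * w x

theorem HasBallMeanValue.const_sub_mul {u : R3 → ℝ} {U : Set R3} (hu : HasBallMeanValue u U)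
    (hc : ContinuousOn u U) (M c : ℝ) : HasBallMeanValue (fun y => M - c * u y) U := by
  intro x ρ hx
  have hi : IntegrableOn u (closedBall x ρ) :=
    (hc.mono hx).integrableOn_compact (isCompact_closedBall x ρ)
  have hM : IntegrableOn (fun _ : R3 => M) (closedBall x ρ) :=
    integrableOn_const measure_closedBall_lt_top.ne
  rw [integral_sub hM (hi.const_mul c), integral_const_mul, hu hx, setIntegral_const,
    Measure.addHaar_real_closedBall_center, smul_eq_mul]
  ring

/-- Comparison of the values of a nonnegative function with the mean value property at the centres
of two nested balls. -/
theorem HasBallMeanValue.pow_mul_le {w : R3 → ℝ} {U : Set R3} (hw : HasBallMeanValue w U)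
    (hc : ContinuousOn w U) (h0 : ∀ y ∈ U, 0 ≤ w y) {x y : R3} {s ρ : ℝ} (hs : 0 ≤ s)
    (hρ : 0 ≤ ρ) (hx : closedBall x ρ ⊆ U) (hyx : closedBall y s ⊆ closedBall x ρ) :
    s ^ 3 * w y ≤ ρ ^ 3 * w x := by
  have hle : ∫ z in closedBall y s, w z ≤ ∫ z in closedBall x ρ, w z :=
    setIntegral_mono_set ((hc.mono hx).integrableOn_compact (isCompact_closedBall x ρ))
      (ae_restrict_of_forall_mem measurableSet_closedBall fun z hz => h0 z (hx hz))
      hyx.eventuallyLE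
  rw [hw hx, hw (hyx.trans hx), Measure.addHaar_real_closedBall _ _ hs,
    Measure.addHaar_real_closedBall _ _ hρ, finrank_euclideanSpace, Fintype.card_fin] at hle
  have hpos : 0 < volume.real (ball (0 : R3) 1) :=
    ENNReal.toReal_pos (measure_ball_pos _ _ one_pos).ne' measure_ball_lt_top.ne
  refine le_of_mul_le_mul_right ?_ hpos
  linarith

/-- The gradient estimate for nonnegative functions with the mean value property. -/
theorem HasBallMeanValue.mul_fderiv_le {w : R3 → ℝ} {U : Set R3} (hw : HasBallMeanValue w U)
    (hc : ContinuousOn w U) (h0 : ∀ y ∈ U, 0 ≤ w y) {x : R3} {ρ : ℝ} (hρ : 0 < ρ)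
    (hx : closedBall x ρ ⊆ U) (hd : DifferentiableAt ℝ w x) (h : R3) :
    ρ * fderiv ℝ w x h ≤ 3 * ‖h‖ * w x := by
  have hline : HasDerivAt (fun s : ℝ => w (x + s • h)) (fderiv ℝ w x h) 0 := by
    have h1 : HasDerivAt (fun s : ℝ => x + s • h) h 0 := by
      simpa using ((hasDerivAt_id (0 : ℝ)).smul_const h).const_add x
    have h2 : HasFDerivAt w (fderiv ℝ w x) (x + (0 : ℝ) • h) := by simpa using hd.hasFDerivAt
    exact h2.comp_hasDerivAt 0 h1
  have hpow : HasDerivAt (fun s : ℝ => (ρ - s * ‖h‖) ^ 3) (-(3 * ρ ^ 2 * ‖h‖)) 0 := by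
    have h1 := (((hasDerivAt_id (0 : ℝ)).mul_const ‖h‖).const_sub ρ).pow 3
    refine HasDerivAt.congr_deriv h1 ?_
    simp
  -- The ball of radius ρ - s‖h‖ about x + sh lies in the ball of radius ρ about x, so (ρ - s‖h‖)³
  -- w(x + sh) is at most its value at s = 0; its right derivative there is therefore ≤ 0.
  have hder := (hpow.mul hline).tendsto_slope_zero_right
  have hsmall : ∀ᶠ s in 𝓝[>] (0 : ℝ), 0 ≤ ρ - s * ‖h‖ := by
    have h1 : ContinuousAt (fun s : ℝ => ρ - s * ‖h‖) 0 := by fun_prop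
    have h2 := h1.eventually_const_lt (show (0 : ℝ) < ρ - 0 * ‖h‖ by simpa using hρ)
    exact (h2.filter_mono nhdsWithin_le_nhds).mono fun s hs => hs.le
  have hle := le_of_tendsto hder (b := 0) (by
    filter_upwards [hsmall, self_mem_nhdsWithin] with s hs hs0
    rw [mem_Ioi] at hs0
    have hsub : closedBall (x + s • h) (ρ - s * ‖h‖) ⊆ closedBall x ρ := by
      apply closedBall_subset_closedBall'
      rw [dist_self_add_left, norm_smul, Real.norm_of_nonneg hs0.le]
      linarith
    have h1 := hw.pow_mul_le hc h0 hs hρ.le hx hsub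
    simp only [Pi.mul_apply, zero_add, zero_mul, sub_zero, zero_smul, add_zero, smul_eq_mul]
    exact mul_nonpos_of_nonneg_of_nonpos (inv_nonneg.2 hs0.le) (by linarith))
  simp only [zero_mul, sub_zero, zero_smul, add_zero] at hle
  have hρ2 : 0 < ρ ^ 2 := by positivity
  refine le_of_mul_le_mul_left ?_ hρ2
  linarith

/-- A bound of the derivative of a bounded function with the mean value property in the unit ball
by its distance from the bound at the centre. -/
theorem HasBallMeanValue.abs_fderiv_le {u : R3 → ℝ} (hu : HasBallMeanValue u (ball 0 1))
    (hd : DifferentiableOn ℝ u (ball 0 1)) {M : ℝ} (hM : ∀ y ∈ ball (0 : R3) 1, |u y| ≤ M)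
    {x : R3} (hx : ‖x‖ < 1) (h : R3) :
    |fderiv ℝ u x h| ≤ 8 / (1 - ‖x‖) ^ 4 * (M - |u 0|) * ‖h‖ := by
  wlog h00 : 0 ≤ u 0 generalizing u
  · have hneg : HasBallMeanValue (fun y => -u y) (ball 0 1) := by
      simpa using hu.const_sub_mul hd.continuousOn 0 1
    have := this hneg hd.neg (by simpa using hM) (by simp; linarith)
    simpa [fderiv_fun_neg] using this
  rw [abs_of_nonneg h00]
  set w : R3 → ℝ := fun y => M - 1 * u y with hwdef
  have hw : HasBallMeanValue w (ball 0 1) := hu.const_sub_mul hd.continuousOn M 1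
  have hc : ContinuousOn w (ball 0 1) := by
    have := hd.continuousOn
    fun_prop
  have hw0 : ∀ y ∈ ball (0 : R3) 1, 0 ≤ w y := fun y hy => by
    have := (abs_le.1 (hM y hy)).2
    simp only [hwdef]
    linarith
  have hxm : x ∈ ball (0 : R3) 1 := by simpa using hx
  have hdx : DifferentiableAt ℝ u x := hd.differentiableAt (isOpen_ball.mem_nhds hxm)
  have hwx : HasFDerivAt w (-fderiv ℝ u x) x := by
    simpa [hwdef] using hdx.hasFDerivAt.const_sub M
  set d := 1 - ‖x‖ with hddef
  have hdpos : 0 < d := by linarith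
  -- Any ratio c < 1 with 3 / c⁴ ≤ 8 would do; c < 1 keeps the closed balls inside the open unit
  -- ball.
  set ρ := 9 / 10 * d with hρdef
  have hρ : 0 < ρ := by positivity
  have hsub : closedBall x ρ ⊆ closedBall 0 (‖x‖ + ρ) := by
    apply closedBall_subset_closedBall'
    rw [dist_zero_right, add_comm]
  have hbig : closedBall (0 : R3) (‖x‖ + ρ) ⊆ ball 0 1 := closedBall_subset_ball (by linarith)
  have hharnack := hw.pow_mul_le hc hw0 hρ.le (by positivity) hbig hsub
  have hwzero : 0 ≤ w 0 := hw0 0 (by simp)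
  have hval : ρ ^ 3 * w x ≤ w 0 := by
    refine hharnack.trans (mul_le_of_le_one_left hwzero (pow_le_one₀ (by positivity) ?_))
    linarith
  have hgrad : ρ * |fderiv ℝ u x h| ≤ 3 * ‖h‖ * w x := by
    have h1 := hw.mul_fderiv_le hc hw0 hρ (hsub.trans hbig) hwx.differentiableAt h
    have h2 := hw.mul_fderiv_le hc hw0 hρ (hsub.trans hbig) hwx.differentiableAt (-h)
    rw [hwx.fderiv] at h1 h2
    simp only [neg_apply, map_neg, neg_neg, norm_neg] at h1 h2
    rcases abs_cases (fderiv ℝ u x h) with ⟨h3, _⟩ | ⟨h3, _⟩ <;> rw [h3] <;> assumption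
  have hfin : ρ ^ 4 * |fderiv ℝ u x h| ≤ 3 * ‖h‖ * w 0 := by
    calc ρ ^ 4 * |fderiv ℝ u x h| = ρ ^ 3 * (ρ * |fderiv ℝ u x h|) := by ring
      _ ≤ ρ ^ 3 * (3 * ‖h‖ * w x) := by gcongr
      _ = 3 * ‖h‖ * (ρ ^ 3 * w x) := by ring
      _ ≤ 3 * ‖h‖ * w 0 := by gcongr
  have hw0eq : w 0 = M - u 0 := by simp [hwdef]
  rw [hw0eq] at hfin hwzero
  have hd4 : 0 < d ^ 4 := by positivity
  rw [div_mul_eq_mul_div, div_mul_eq_mul_div, le_div_iff₀ hd4]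
  have hρ4 : ρ ^ 4 = 6561 / 10000 * d ^ 4 := by rw [hρdef]; ring
  rw [hρ4] at hfin
  nlinarith [mul_nonneg (norm_nonneg h) hwzero]

/-! ### Quaternion coordinates and the Riesz system -/

/-- The scalar part as a continuous linear functional. -/
noncomputable def reL : ℍ[ℝ] →L[ℝ] ℝ := ⟨QuaternionAlgebra.reₗ _ _ _, Quaternion.continuous_re⟩

/-- The `imI` coordinate as a continuous linear functional. -/
noncomputable def imIL : ℍ[ℝ] →L[ℝ] ℝ := ⟨QuaternionAlgebra.imIₗ _ _ _, Quaternion.continuous_imI⟩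

/-- The `imJ` coordinate as a continuous linear functional. -/
noncomputable def imJL : ℍ[ℝ] →L[ℝ] ℝ := ⟨QuaternionAlgebra.imJₗ _ _ _, Quaternion.continuous_imJ⟩

/-- The `imK` coordinate as a continuous linear functional. -/
noncomputable def imKL : ℍ[ℝ] →L[ℝ] ℝ := ⟨QuaternionAlgebra.imKₗ _ _ _, Quaternion.continuous_imK⟩

theorem imK_eq_zero_of_mem_reducedQuaternions {q : ℍ[ℝ]} (hq : q ∈ reducedQuaternions) :
    q.imK = 0 := by
  have h : reducedQuaternions ≤ LinearMap.ker (imKL : ℍ[ℝ] →ₗ[ℝ] ℝ) := by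
    rw [reducedQuaternions, Submodule.span_le]
    rintro z (rfl | rfl | rfl) <;> exact rfl
  exact h hq

theorem abs_re_le_norm (q : ℍ[ℝ]) : |q.re| ≤ ‖q‖ := by
  refine abs_le_of_sq_le_sq ?_ (norm_nonneg q)
  rw [pow_two ‖q‖, ← Quaternion.normSq_eq_norm_mul_self, Quaternion.normSq_def']
  nlinarith [sq_nonneg q.imI, sq_nonneg q.imJ, sq_nonneg q.imK]

theorem fderiv_clm_comp {f : R3 → ℍ[ℝ]} {x : R3} (hf : DifferentiableAt ℝ f x)
    (l : ℍ[ℝ] →L[ℝ] ℝ) (h : R3) : fderiv ℝ (fun y => l (f y)) x h = l (fderiv ℝ f x h) := by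
  have := (l.hasFDerivAt.comp x hf.hasFDerivAt).fderiv
  exact DFunLike.congr_fun this h

theorem fderiv_apply_eq (g : R3 → ℍ[ℝ]) (x y : R3) : fderiv ℝ g x y =
    y 0 • partialD 0 g x + y 1 • partialD 1 g x + y 2 • partialD 2 g x := by
  have hy : y = y 0 • basisVec 0 + y 1 • basisVec 1 + y 2 • basisVec 2 := by
    ext i
    fin_cases i <;> simp
  conv_lhs => rw [hy]
  simp [partialD]

namespace IsMonogenicOn

variable {f : R3 → ℍ[ℝ]} {Ω : Set R3}

theorem differentiableAt (hf : IsMonogenicOn f Ω) (hΩ : IsOpen Ω) {x : R3} (hx : x ∈ Ω) :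
    DifferentiableAt ℝ f x :=
  (hf.contDiffOn.contDiffAt (hΩ.mem_nhds hx)).differentiableAt (by norm_num)

theorem imK_fderiv (hf : IsMonogenicOn f Ω) (hΩ : IsOpen Ω) {x : R3} (hx : x ∈ Ω) (h : R3) :
    (fderiv ℝ f x h).imK = 0 := by
  have h1 := fderiv_clm_comp (hf.differentiableAt hΩ hx) imKL h
  have h2 : (fun y => imKL (f y)) =ᶠ[𝓝 x] fun _ => 0 := by
    filter_upwards [hΩ.mem_nhds hx] with y hy
    exact imK_eq_zero_of_mem_reducedQuaternions (hf.mem_reduced y hy)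
  rw [h2.fderiv_eq, fderiv_fun_const] at h1
  exact h1.symm

/-- The Riesz system in coordinates. -/
theorem riesz_system (hf : IsMonogenicOn f Ω) (hΩ : IsOpen Ω) {x : R3} (hx : x ∈ Ω) :
    (partialD 0 f x).re = (partialD 1 f x).imI + (partialD 2 f x).imJ ∧
      (partialD 1 f x).re = -(partialD 0 f x).imI ∧
      (partialD 2 f x).re = -(partialD 0 f x).imJ := by
  have h := hf.cauchyRiemann_eq_zero x hx
  have h1 : (partialD 1 f x).imK = 0 := hf.imK_fderiv hΩ hx _
  have h2 : (partialD 2 f x).imK = 0 := hf.imK_fderiv hΩ hx _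
  have hre := congrArg QuaternionAlgebra.re h
  have hI := congrArg QuaternionAlgebra.imI h
  have hJ := congrArg QuaternionAlgebra.imJ h
  have he₁ : e₁.re = 0 ∧ e₁.imI = 1 ∧ e₁.imJ = 0 ∧ e₁.imK = 0 := ⟨rfl, rfl, rfl, rfl⟩
  have he₂ : e₂.re = 0 ∧ e₂.imI = 0 ∧ e₂.imJ = 1 ∧ e₂.imK = 0 := ⟨rfl, rfl, rfl, rfl⟩
  simp only [cauchyRiemann, Quaternion.re_add, Quaternion.imI_add, Quaternion.imJ_add,
    Quaternion.re_mul, Quaternion.imI_mul, Quaternion.imJ_mul, Quaternion.re_zero,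
    Quaternion.imI_zero, Quaternion.imJ_zero, he₁, he₂, h1, h2] at hre hI hJ
  exact ⟨by linarith, by linarith, by linarith⟩

/-- `D̄ = 2∂₀ - D`, and `D f` vanishes. -/
theorem hypercomplexDeriv_eq (hf : IsMonogenicOn f Ω) {x : R3} (hx : x ∈ Ω) :
    hypercomplexDeriv f x = partialD 0 f x := by
  have h := hf.cauchyRiemann_eq_zero x hx
  have h1 : cauchyRiemannConj f x = (2 : ℝ) • partialD 0 f x := by
    rw [← sub_zero (cauchyRiemannConj f x), ← neg_zero, ← h, cauchyRiemannConj, cauchyRiemann,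
      two_smul]
    abel
  rw [hypercomplexDeriv, h1, smul_smul]
  norm_num

/-- The Riesz system turns y·∇u into (y₀∂₁ - y₁∂₀)u₁ + (y₀∂₂ - y₂∂₀)u₂. -/
theorem hasBallMeanValue_re (hf : IsMonogenicOn f Ω) (hΩ : IsOpen Ω) :
    HasBallMeanValue (fun y => (f y).re) Ω := by
  intro x ρ hx
  refine setIntegral_closedBall_eq_of_radial_eq hΩ (u := fun y => reL (f y))
    (u₁ := fun y => imIL (f y)) (u₂ := fun y => imJL (f y))
    (reL.contDiff.comp_contDiffOn hf.contDiffOn) (imIL.contDiff.comp_contDiffOn hf.contDiffOn)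
    (imJL.contDiff.comp_contDiffOn hf.contDiffOn) (fun z hz y => ?_) hx
  have hd := hf.differentiableAt hΩ hz
  obtain ⟨h0, h1, h2⟩ := hf.riesz_system hΩ hz
  rw [fderiv_clm_comp hd, fderiv_clm_comp hd, fderiv_clm_comp hd, fderiv_apply_eq]
  simp only [map_add, map_sub, map_smul, smul_eq_mul]
  change y 0 * (partialD 0 f z).re + y 1 * (partialD 1 f z).re + y 2 * (partialD 2 f z).re =
    y 0 * (partialD 1 f z).imI - y 1 * (partialD 0 f z).imI +
      (y 0 * (partialD 2 f z).imJ - y 2 * (partialD 0 f z).imJ)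
  rw [h0, h1, h2]
  ring

/-- The squared modulus of the hypercomplex derivative is the derivative of the scalar part in the
direction of its gradient. -/
theorem exists_norm_hypercomplexDeriv_sq_eq (hf : IsMonogenicOn f Ω) (hΩ : IsOpen Ω) {x : R3}
    (hx : x ∈ Ω) : ∃ h : R3, ‖h‖ = ‖hypercomplexDeriv f x‖ ∧
      fderiv ℝ (fun y => (f y).re) x h = ‖hypercomplexDeriv f x‖ ^ 2 := by
  obtain ⟨-, h1, h2⟩ := hf.riesz_system hΩ hx
  have h3 : (partialD 0 f x).imK = 0 := hf.imK_fderiv hΩ hx _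
  have hsq : ‖hypercomplexDeriv f x‖ ^ 2 =
      (partialD 0 f x).re ^ 2 + (partialD 1 f x).re ^ 2 + (partialD 2 f x).re ^ 2 := by
    rw [hf.hypercomplexDeriv_eq hx, pow_two ‖_‖, ← Quaternion.normSq_eq_norm_mul_self,
      Quaternion.normSq_def', h1, h2, h3]
    ring
  refine ⟨!₂[(partialD 0 f x).re, (partialD 1 f x).re, (partialD 2 f x).re], ?_, ?_⟩
  · rw [EuclideanSpace.norm_eq, ← Real.sqrt_sq (norm_nonneg (hypercomplexDeriv f x)), hsq]
    simp [Fin.sum_univ_three]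
  · have h4 := fderiv_clm_comp (hf.differentiableAt hΩ hx) reL
      !₂[(partialD 0 f x).re, (partialD 1 f x).re, (partialD 2 f x).re]
    refine h4.trans ?_
    rw [fderiv_apply_eq, hsq]
    simp only [map_add, map_smul, smul_eq_mul]
    change (partialD 0 f x).re * (partialD 0 f x).re + (partialD 1 f x).re * (partialD 1 f x).re +
      (partialD 2 f x).re * (partialD 2 f x).re = _
    ring

theorem norm_hypercomplexDeriv_le (hf : IsMonogenicOn f (ball 0 1)) {M : ℝ}
    (hM : ∀ y ∈ ball (0 : R3) 1, ‖f y‖ ≤ M) {x : R3} (hx : ‖x‖ < 1) :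
    ‖hypercomplexDeriv f x‖ ≤ 8 / (1 - ‖x‖) ^ 4 * (M - |(f 0).re|) := by
  have hxm : x ∈ ball (0 : R3) 1 := by simpa using hx
  obtain ⟨h, hh, heq⟩ := hf.exists_norm_hypercomplexDeriv_sq_eq isOpen_ball hxm
  have hd : DifferentiableOn ℝ (fun y => (f y).re) (ball 0 1) := fun y hy =>
    (reL.differentiableAt.comp y (hf.differentiableAt isOpen_ball hy)).differentiableWithinAt
  have hb := (hf.hasBallMeanValue_re isOpen_ball).abs_fderiv_le hd
    (fun y hy => (abs_re_le_norm _).trans (hM y hy)) hx h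
  rw [heq, hh, abs_of_nonneg (sq_nonneg _)] at hb
  have hM0 : |(f 0).re| ≤ M := (abs_re_le_norm _).trans (hM 0 (by simp))
  have hpos : 0 ≤ 8 / (1 - ‖x‖) ^ 4 * (M - |(f 0).re|) :=
    mul_nonneg (by positivity) (by linarith)
  -- `hb` bounds the square of the norm by a constant times the norm; one factor cancels unless it
  -- is zero.
  rcases (norm_nonneg (hypercomplexDeriv f x)).eq_or_lt with h0 | h0
  · rw [← h0]
    exact hpos
  · refine le_of_mul_le_mul_right ?_ h0
    rw [← pow_two]
    exact hb

theorem continuousOn_hypercomplexDeriv (hf : IsMonogenicOn f Ω) (hΩ : IsOpen Ω) :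
    ContinuousOn (hypercomplexDeriv f) Ω := by
  have h := hf.contDiffOn.continuousOn_fderiv_of_isOpen hΩ le_rfl
  refine ContinuousOn.congr (f := partialD 0 f) ?_ fun x hx => hf.hypercomplexDeriv_eq hx
  exact h.clm_apply continuousOn_const

end IsMonogenicOn

/-! ### Attainment of the maximum and conclusion -/

theorem exists_enorm_eq_maxModulus {g : R3 → ℍ[ℝ]} {r : ℝ} (hr : 0 ≤ r)
    (hg : ContinuousOn g (sphere 0 r)) :
    ∃ x ∈ sphere (0 : R3) r, ‖g x‖ₑ = maxModulus g r := by
  obtain ⟨x, hx, hmax⟩ := (isCompact_sphere (0 : R3) r).exists_isMaxOn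
    (NormedSpace.sphere_nonempty.2 hr) hg.enorm
  exact ⟨x, hx, le_antisymm (le_iSup₂_of_le x hx le_rfl) (iSup₂_le fun y hy => hmax hy)⟩

end Riesz

theorem theorem5p1 (f : Riesz.R3 → ℍ[ℝ])
    (hf : Riesz.IsMonogenicOn f (Metric.ball 0 1))
    (hf2 : MeasureTheory.MemLp f 2 (MeasureTheory.volume.restrict (Metric.ball 0 1)))
    (r : ℝ) (hr0 : 0 ≤ r) (hr1 : r < 1) :
    (∃ x ∈ Metric.sphere (0 : Riesz.R3) r,
      ‖Riesz.hypercomplexDeriv f x‖ₑ = Riesz.maxModulus (Riesz.hypercomplexDeriv f) r) ∧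
    Riesz.maxModulus (Riesz.hypercomplexDeriv f) r ≤
      ENNReal.ofReal (8 * (3 * r + 1) / (1 - r) ^ 5) *
        (Riesz.supModulus f 1 - ‖(f 0).re‖ₑ) := by
  have hsub : Metric.sphere (0 : Riesz.R3) r ⊆ Metric.ball 0 1 := fun x hx => by
    rw [mem_sphere_zero_iff_norm] at hx
    simpa [hx] using hr1
  have h1r : 0 < 1 - r := by linarith
  refine ⟨Riesz.exists_enorm_eq_maxModulus hr0
    ((hf.continuousOn_hypercomplexDeriv Metric.isOpen_ball).mono hsub), iSup₂_le fun x hx => ?_⟩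
  have hxr : ‖x‖ = r := by simpa using hx
  have hC : 0 < 8 * (3 * r + 1) / (1 - r) ^ 5 := by positivity
  by_cases htop : Riesz.supModulus f 1 = ⊤
  · rw [htop, ENNReal.top_sub enorm_ne_top, ENNReal.mul_top (by simpa using hC)]
    exact le_top
  set M := (Riesz.supModulus f 1).toReal with hMdef
  have hM : ∀ y ∈ Metric.ball (0 : Riesz.R3) 1, ‖f y‖ ≤ M := fun y hy => by
    have h : ‖f y‖ₑ ≤ Riesz.supModulus f 1 := le_iSup₂_of_le y hy le_rfl
    simpa using ENNReal.toReal_mono htop h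
  have hM0 : |(f 0).re| ≤ M := (Riesz.abs_re_le_norm _).trans (hM 0 (by simp))
  rw [← ENNReal.ofReal_toReal htop, ← hMdef, Real.enorm_eq_ofReal_abs,
    ← ENNReal.ofReal_sub _ (abs_nonneg _), ← ENNReal.ofReal_mul hC.le, ← ofReal_norm]
  apply ENNReal.ofReal_le_ofReal
  refine (hf.norm_hypercomplexDeriv_le hM (hxr ▸ hr1)).trans ?_
  rw [hxr]
  refine mul_le_mul_of_nonneg_right ?_ (by linarith)
  -- The fourth-power bound implies the stated one because 1 - r ≤ 3r + 1.
  rw [div_le_div_iff₀ (by positivity) (by positivity)]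
  have h4 : 0 < (1 - r) ^ 4 := by positivity
  nlinarith [mul_nonneg hr0 h4.le]
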